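/- Let $d\ge 1$ be an integer and let $\{X_n\}_{n\in\mathbb Z^d}$ be independent, identically distributed real random variables with finite moments of all orders and $\mathbb E[X_n]=0$. A multi-index is a finitely supported function $\beta:\mathbb Z^d\to\{0,1,2,\dots\}$, $n\mapsto\beta_n$; put $X^\beta=\prod_{n\in\mathbb Z^d}X_n^{\beta_n}$, and for $i\in\mathbb Z^d$ let $\beta^i$ be the shifted multi-index $\beta^i_n=\beta_{n-i}$. For $L\in\mathbb N$ let $\Lambda_L=[-L,L]\cap\mathbb Z$. Let $B$ be any set of multi-indices such that $\beta_0>0$ for every $\beta\in B$, and let $\{a_\beta\}_{\beta\in B}$ be real coefficients such that $a_\beta=0$ for all but finitely many $\beta\in B$. Then there is $\sigma^2\ge 0$ such that $$\frac{1}{(2L+1)^{d/2}}\sum_{\beta\in B}a_\beta\sum_{i\in\Lambda_L^d}\left(X^{\beta^i}-\mathbb E\left[X^{\beta^i}\right]\right)\ \overset{d}{\longrightarrow}\ N(0,\sigma^2)\qquad\text{as } L\to\infty,$$ where $N(0,\sigma^2)$ is the normal law with mean $0$ and variance $\sigma^2$, and $N(0,0)$ is the point mass at $0$. -/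

import Mathlib

open MeasureTheory ProbabilityTheory Filter

namespace AndersonCLT

/-- A multi-index on the lattice `ℤ^d`: a finitely supported function `ℤ^d → {0, 1, 2, …}`. -/
abbrev MultiIndex (d : ℕ) : Type := (Fin d → ℤ) →₀ ℕ

/-- The multi-index `β` shifted by `i`, whose value at `n` is `β (n - i)`. -/
def shift {d : ℕ} (β : MultiIndex d) (i : Fin d → ℤ) : MultiIndex d :=
  Finsupp.equivMapDomain (Equiv.addRight i) β

theorem shift_apply {d : ℕ} (β : MultiIndex d) (i n : Fin d → ℤ) :
    shift β i n = β (n - i) := by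
  simp [shift, Finsupp.equivMapDomain_apply, sub_eq_add_neg]

/-- The random monomial `X^β = ∏ₙ Xₙ ^ βₙ` (the product over the support of `β`). -/
def monomial {d : ℕ} {Ω : Type*} (X : (Fin d → ℤ) → Ω → ℝ) (β : MultiIndex d) (ω : Ω) : ℝ :=
  β.prod fun n k => X n ω ^ k

/-- The cube `([-L, L] ∩ ℤ)^d` in `ℤ^d`. -/
noncomputable def box (d L : ℕ) : Finset (Fin d → ℤ) :=
  Fintype.piFinset fun _ => Finset.Icc (-(L : ℤ)) (L : ℤ)

end AndersonCLT

/-!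
The field `Yᵢ = ∑ β, a β (X^(βⁱ) - 𝔼 X^(βⁱ))` is a translate by `i` of one fixed polynomial in finitely
many variables of an i.i.d. family. It is therefore stationary, square integrable and of finite
range: sums over sets of sites at distance more than some `R` are independent
(`isFiniteRangeField_of_local`). Its normalized sums over boxes are treated by Bernstein's block method.

The box is cut into cells of side `m + R`, and in each cell a block of side `m` is kept. Distinct
blocks are at distance more than `R`, so the block sums are i.i.d. and, for fixed `m`, the classical
central limit theorem gives a Gaussian limit for their normalized total as `L → ∞`
(`charFun_sum_biUnion_block`, `tendsto_charFun_map_inv_sqrt_pow`). Since each site is correlated with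
a bounded number of others, second moments of weighted sums are bounded by the `ℓ²` norm of the weights
(`IsFiniteRangeField.integral_sum_mul_sq_le`). So the block total differs from the full sum
in `L²` by an amount of order `√(1 - (m / (m + R))^d)`, which is small for large `m`, and the
characteristic functions differ by as little (`norm_charFun_map_sub_le`).

The block variances per unit volume are bounded. Choosing a convergent subsequence of them, the
characteristic functions of the full sums are eventually as close as desired to a single Gaussian
one, and Lévy's theorem concludes.
-/

open scoped Topology

namespace AndersonCLT

/-! ### Characteristic functions -/

/-- Characteristic functions are Lipschitz in the random variable for the `L²` norm, since
`|e^{iu} - e^{iv}| ≤ |u - v|`. Replacing a random variable by an `L²`-close one is thus harmless. -/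
theorem norm_charFun_map_sub_le {Ω : Type*} [MeasurableSpace Ω] {P : Measure Ω}
    [IsProbabilityMeasure P] {U V : Ω → ℝ} (hU : MemLp U 2 P) (hV : MemLp V 2 P) (t : ℝ) :
    ‖charFun (P.map U) t - charFun (P.map V) t‖ ≤ |t| * √(∫ ω, (U ω - V ω) ^ 2 ∂P) := by
  have hcont : Continuous fun x : ℝ => Complex.exp (t * x * Complex.I) := by fun_prop
  have hint : ∀ {W : Ω → ℝ}, MemLp W 2 P →
      Integrable (fun ω => Complex.exp (t * W ω * Complex.I)) P := fun {W} hW => by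
    refine Integrable.of_bound
      (hcont.comp_aestronglyMeasurable hW.aestronglyMeasurable) 1 (ae_of_all _ fun ω => ?_)
    have := Complex.norm_exp_ofReal_mul_I (t * W ω)
    push_cast at this
    exact this.le
  have hD : MemLp (fun ω => U ω - V ω) 2 P := hU.sub hV
  have hDabs : MemLp (fun ω => |U ω - V ω|) 2 P := hD.norm
  have hpt : ∀ ω, ‖Complex.exp (t * U ω * Complex.I) - Complex.exp (t * V ω * Complex.I)‖
      ≤ |t| * |U ω - V ω| := fun ω => by
    have h1 : Complex.exp (t * U ω * Complex.I) - Complex.exp (t * V ω * Complex.I)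
        = Complex.exp ((t * V ω : ℝ) * Complex.I)
          * (Complex.exp (Complex.I * (t * (U ω - V ω) : ℝ)) - 1) := by
      rw [mul_sub, ← Complex.exp_add, mul_one]
      push_cast
      ring_nf
    rw [h1, norm_mul, Complex.norm_exp_ofReal_mul_I, one_mul, ← abs_mul]
    exact Real.norm_exp_I_mul_ofReal_sub_one_le
  have hL1 : ∫ ω, |U ω - V ω| ∂P ≤ √(∫ ω, (U ω - V ω) ^ 2 ∂P) := by
    -- Jensen's inequality, in the form that the variance of `|U - V|` is nonnegative.
    apply Real.le_sqrt_of_sq_le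
    have h := variance_eq_sub hDabs
    have h0 := variance_nonneg (fun ω => |U ω - V ω|) P
    have h2 : P[(fun ω => |U ω - V ω|) ^ 2] = ∫ ω, (U ω - V ω) ^ 2 ∂P := by
      simp [Pi.pow_apply, sq_abs]
    rw [h2] at h
    linarith
  rw [charFun_apply_real, charFun_apply_real,
    integral_map hU.aestronglyMeasurable.aemeasurable hcont.aestronglyMeasurable,
    integral_map hV.aestronglyMeasurable.aemeasurable hcont.aestronglyMeasurable,
    ← integral_sub (hint hU) (hint hV)]
  calc _ ≤ ∫ ω, |t| * |U ω - V ω| ∂P :=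
        norm_integral_le_of_norm_le ((hDabs.integrable one_le_two).const_mul _)
          (ae_of_all _ hpt)
    _ = |t| * ∫ ω, |U ω - V ω| ∂P := integral_const_mul _ _
    _ ≤ _ := by gcongr

/-- The classical central limit theorem for characteristic functions, at an arbitrary (possibly zero)
variance; the `n`-th power is the characteristic function of a sum of `n` independent copies. -/
theorem tendsto_charFun_map_inv_sqrt_pow {Ω : Type*} [MeasurableSpace Ω] {P : Measure Ω}
    [IsProbabilityMeasure P] {Z : Ω → ℝ} (hZ : MemLp Z 2 P) (h0 : ∫ ω, Z ω ∂P = 0) (t : ℝ) :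
    Tendsto (fun n : ℕ => charFun (P.map Z) ((√n)⁻¹ * t) ^ n) atTop
      (𝓝 (Complex.exp (-(∫ ω, Z ω ^ 2 ∂P) * t ^ 2 / 2))) := by
  have hm : AEMeasurable Z P := hZ.aestronglyMeasurable.aemeasurable
  obtain hv | hv := eq_or_ne (∫ ω, Z ω ^ 2 ∂P) 0
  · have hae : Z =ᵐ[P] fun _ => 0 := by
      have := (integral_eq_zero_iff_of_nonneg (fun ω => sq_nonneg (Z ω)) hZ.integrable_sq).1 hv
      filter_upwards [this] with ω hω
      simpa using hω
    rw [hv, Measure.map_congr hae]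
    simp
  · set s := √(∫ ω, Z ω ^ 2 ∂P) with hs
    have hpos : 0 < ∫ ω, Z ω ^ 2 ∂P := lt_of_le_of_ne (integral_nonneg fun ω => sq_nonneg _) hv.symm
    have hs2 : s ^ 2 = ∫ ω, Z ω ^ 2 ∂P := Real.sq_sqrt hpos.le
    have hs0 : s ≠ 0 := (Real.sqrt_pos.2 hpos).ne'
    have key := tendsto_charFun_inv_sqrt_mul_pow (P := P) (X := fun ω => s⁻¹ * Z ω)
      (hm.const_mul _) (by simp [integral_const_mul, h0])
      (by simp only [Pi.pow_apply, mul_pow]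
          rw [integral_const_mul, ← hs2, inv_pow, inv_mul_cancel₀ (pow_ne_zero 2 hs0)]) (s * t)
    have e1 : ∀ n : ℕ, charFun (P.map fun ω => s⁻¹ * Z ω) ((√n)⁻¹ * (s * t))
        = charFun (P.map Z) ((√n)⁻¹ * t) := fun n => by
      rw [charFun_map_mul_comp hm]
      congr 1
      field_simp
    simp only [e1] at key
    convert key using 3
    rw [← hs2]
    push_cast
    ring

/-! ### Blocks in the lattice -/

/-- The cube `{0, …, m - 1}^d`. -/
noncomputable def cube (d m : ℕ) : Finset (Fin d → ℤ) :=
  Fintype.piFinset fun _ => Finset.Ico 0 (m : ℤ)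

/-- The cube of side `m` whose lowest corner is `o + q c`. As `c` varies, the lattice is tiled by
cells of side `q`, and this is the part of cell `c` that is left after removing a corridor of
width `q - m`. -/
noncomputable def block {d : ℕ} (o : Fin d → ℤ) (q m : ℕ) (c : Fin d → ℤ) : Finset (Fin d → ℤ) :=
  (cube d m).map (addLeftEmbedding (o + (q : ℤ) • c))

theorem mem_cube {d m : ℕ} {x : Fin d → ℤ} : x ∈ cube d m ↔ ∀ k, 0 ≤ x k ∧ x k < m := by
  simp [cube]

theorem card_cube (d m : ℕ) : (cube d m).card = m ^ d := by
  simp [cube, Fintype.card_piFinset]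

theorem mem_box {d L : ℕ} {x : Fin d → ℤ} : x ∈ box d L ↔ ∀ k, -(L : ℤ) ≤ x k ∧ x k ≤ L := by
  simp [box]

theorem card_box (d L : ℕ) : (box d L).card = (2 * L + 1) ^ d := by
  simp only [box, Fintype.card_piFinset, Int.card_Icc, Finset.prod_const, Finset.card_univ,
    Fintype.card_fin]
  congr 1
  omega

theorem mem_block {d : ℕ} {o : Fin d → ℤ} {q m : ℕ} {c x : Fin d → ℤ} :
    x ∈ block o q m c ↔ ∀ k, o k + q * c k ≤ x k ∧ x k < o k + q * c k + m := by
  simp only [block, Finset.mem_map, addLeftEmbedding_apply, mem_cube]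
  constructor
  · rintro ⟨j, hj, rfl⟩ k
    have := hj k
    simp only [Pi.add_apply, Pi.smul_apply, smul_eq_mul]
    omega
  · intro h
    refine ⟨x - (o + (q : ℤ) • c), fun k => ?_, by abel⟩
    have := h k
    simp only [Pi.sub_apply, Pi.add_apply, Pi.smul_apply, smul_eq_mul]
    omega

theorem exists_lt_abs_sub_of_mem_block {d : ℕ} {o : Fin d → ℤ} {R m : ℕ} {c c' x y : Fin d → ℤ}
    (hc : c ≠ c') (hx : x ∈ block o (m + R) m c) (hy : y ∈ block o (m + R) m c') :
    ∃ k, (R : ℤ) < |x k - y k| := by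
  obtain ⟨k, hk⟩ := Function.ne_iff.1 hc
  refine ⟨k, ?_⟩
  have hx := mem_block.1 hx k
  have hy := mem_block.1 hy k
  have hq : (0 : ℤ) ≤ ((m + R : ℕ) : ℤ) := by positivity
  push_cast at *
  rw [lt_abs]
  obtain h | h := lt_or_gt_of_ne hk
  · right
    have : ((m : ℤ) + R) * (c k + 1) ≤ (m + R) * c' k := mul_le_mul_of_nonneg_left h hq
    linarith
  · left
    have : ((m : ℤ) + R) * (c' k + 1) ≤ (m + R) * c k := mul_le_mul_of_nonneg_left h hq
    linarith

theorem pairwiseDisjoint_block {d : ℕ} (o : Fin d → ℤ) (R m : ℕ) (C : Set (Fin d → ℤ)) :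
    C.PairwiseDisjoint (block o (m + R) m) := by
  intro c _ c' _ hcc
  refine Finset.disjoint_left.2 fun x hx hx' => ?_
  obtain ⟨k, hk⟩ := exists_lt_abs_sub_of_mem_block hcc hx hx'
  simp at hk
  omega

theorem card_biUnion_block {d : ℕ} (o : Fin d → ℤ) (R m : ℕ) (C : Finset (Fin d → ℤ)) :
    (C.biUnion (block o (m + R) m)).card = C.card * m ^ d := by
  rw [Finset.card_biUnion (pairwiseDisjoint_block o R m _),
    Finset.sum_const_nat (m := m ^ d) fun c _ => by simp [block, card_cube]]

theorem biUnion_block_subset_box {d L q m n : ℕ} (hmq : m ≤ q) (hn : q * n ≤ 2 * L + 1) :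
    (cube d n).biUnion (block (fun _ => -(L : ℤ)) q m) ⊆ box d L := by
  intro x hx
  obtain ⟨c, hc, hx⟩ := Finset.mem_biUnion.1 hx
  refine mem_box.2 fun k => ?_
  have hc := mem_cube.1 hc k
  have hx := mem_block.1 hx k
  have hq : (0 : ℤ) ≤ q := by positivity
  have h1 : (0 : ℤ) ≤ q * c k := mul_nonneg hq hc.1
  have h2 : (q : ℤ) * (c k + 1) ≤ q * n := mul_le_mul_of_nonneg_left hc.2 hq
  have h3 : (q : ℤ) * n ≤ 2 * L + 1 := by exact_mod_cast hn
  have h4 : (m : ℤ) ≤ q := by exact_mod_cast hmq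
  constructor <;> linarith

/-! ### The central limit theorem for fields of finite range -/

/-- A centred square-integrable random field on `ℤ^d` that is stationary and has dependence range
`R`. Stationarity and independence are required only of finite sums, which is all the block argument
uses; two finite sets of sites are at distance more than `R` when any two of their points differ by
more than `R` in some coordinate (the sup distance). -/
structure IsFiniteRangeField {d : ℕ} {Ω : Type*} [MeasurableSpace Ω] (Y : (Fin d → ℤ) → Ω → ℝ)
    (R : ℕ) (P : Measure Ω) : Prop where
  memLp : ∀ i, MemLp (Y i) 2 P
  integral_eq_zero : ∀ i, ∫ ω, Y i ω ∂P = 0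
  identDistrib_sum : ∀ (S : Finset (Fin d → ℤ)) (i : Fin d → ℤ),
    IdentDistrib (fun ω => ∑ j ∈ S, Y (i + j) ω) (fun ω => ∑ j ∈ S, Y j ω) P P
  indepFun_sum : ∀ S T : Finset (Fin d → ℤ),
    (∀ x ∈ S, ∀ y ∈ T, ∃ k, (R : ℤ) < |x k - y k|) →
      IndepFun (fun ω => ∑ x ∈ S, Y x ω) (fun ω => ∑ y ∈ T, Y y ω) P

namespace IsFiniteRangeField

variable {d : ℕ} {Ω : Type*} [MeasurableSpace Ω] {P : Measure Ω}
  {Y : (Fin d → ℤ) → Ω → ℝ} {R : ℕ}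

theorem integral_mul_eq_zero (h : IsFiniteRangeField Y R P) {i j : Fin d → ℤ}
    (hij : ∃ k, (R : ℤ) < |i k - j k|) : ∫ ω, Y i ω * Y j ω ∂P = 0 := by
  have hind := h.indepFun_sum {i} {j} (by simpa using hij)
  simp only [Finset.sum_singleton] at hind
  rw [hind.integral_fun_mul_eq_mul_integral (h.memLp i).aestronglyMeasurable
    (h.memLp j).aestronglyMeasurable, h.integral_eq_zero, zero_mul]

theorem integral_sq_eq (h : IsFiniteRangeField Y R P) (i : Fin d → ℤ) :
    ∫ ω, Y i ω ^ 2 ∂P = ∫ ω, Y 0 ω ^ 2 ∂P := by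
  have hid := (h.identDistrib_sum {0} i).sq
  simp only [Finset.sum_singleton, add_zero] at hid
  exact hid.integral_eq

theorem abs_integral_mul_le (h : IsFiniteRangeField Y R P) (i j : Fin d → ℤ) :
    |∫ ω, Y i ω * Y j ω ∂P| ≤ ∫ ω, Y 0 ω ^ 2 ∂P := by
  rw [← Real.norm_eq_abs]
  calc ‖∫ ω, Y i ω * Y j ω ∂P‖ ≤ ∫ ω, (Y i ω ^ 2 + Y j ω ^ 2) / 2 ∂P := by
        refine norm_integral_le_of_norm_le
          (g := fun ω => (Y i ω ^ 2 + Y j ω ^ 2) / 2)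
          (((h.memLp i).integrable_sq.add (h.memLp j).integrable_sq).div_const 2)
          (ae_of_all _ fun ω => ?_)
        rw [Real.norm_eq_abs, abs_le]
        constructor <;> nlinarith [sq_nonneg (Y i ω + Y j ω), sq_nonneg (Y i ω - Y j ω)]
    _ = _ := by
        rw [integral_div, integral_add (h.memLp i).integrable_sq (h.memLp j).integrable_sq,
          h.integral_sq_eq i, h.integral_sq_eq j]
        ring

theorem card_filter_close_le (S : Finset (Fin d → ℤ)) (R : ℕ) (i : Fin d → ℤ) :
    (S.filter fun j => ∀ k, |i k - j k| ≤ (R : ℤ)).card ≤ (2 * R + 1) ^ d := by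
  calc _ ≤ (Fintype.piFinset fun k => Finset.Icc (i k - R) (i k + R)).card := by
        refine Finset.card_le_card fun j hj => ?_
        simp only [Finset.mem_filter, Fintype.mem_piFinset, Finset.mem_Icc] at hj ⊢
        intro k
        have := abs_le.1 (hj.2 k)
        omega
    _ = _ := by
        simp only [Fintype.card_piFinset, Int.card_Icc]
        rw [Finset.prod_congr rfl fun k _ =>
          show (i k + R + 1 - (i k - R)).toNat = 2 * R + 1 by omega]
        simp

/-- Second moments of weighted sums of a field of range `R` are at most a constant times the `ℓ²` norm
of the weights: each site is correlated with at most `(2 R + 1)^d` others, and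
`|wᵢ wⱼ| ≤ (wᵢ² + wⱼ²) / 2`. -/
theorem integral_sum_mul_sq_le (h : IsFiniteRangeField Y R P) (w : (Fin d → ℤ) → ℝ)
    (S : Finset (Fin d → ℤ)) :
    ∫ ω, (∑ i ∈ S, w i * Y i ω) ^ 2 ∂P
      ≤ (2 * R + 1) ^ d * (∫ ω, Y 0 ω ^ 2 ∂P) * ∑ i ∈ S, w i ^ 2 := by
  classical
  set s := ∫ ω, Y 0 ω ^ 2 ∂P
  have hs0 : 0 ≤ s := integral_nonneg fun ω => sq_nonneg _
  have hint : ∀ i j, Integrable (fun ω => Y i ω * Y j ω) P := fun i j =>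
    (h.memLp i).integrable_mul (h.memLp j)
  have hterm : ∀ i j, w i * w j * ∫ ω, Y i ω * Y j ω ∂P
      ≤ if ∀ k, |i k - j k| ≤ (R : ℤ) then (w i ^ 2 + w j ^ 2) / 2 * s else 0 := fun i j => by
    split_ifs with hc
    · calc _ ≤ |w i * w j * ∫ ω, Y i ω * Y j ω ∂P| := le_abs_self _
        _ = |w i * w j| * |∫ ω, Y i ω * Y j ω ∂P| := abs_mul _ _
        _ ≤ _ := by
          refine mul_le_mul ?_ (h.abs_integral_mul_le i j) (abs_nonneg _) (by positivity)
          rw [abs_le]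
          constructor <;> nlinarith [sq_nonneg (w i + w j), sq_nonneg (w i - w j)]
    · push Not at hc
      rw [h.integral_mul_eq_zero hc, mul_zero]
  have hrow : ∑ i ∈ S, ∑ j ∈ S, (if ∀ k, |i k - j k| ≤ (R : ℤ) then w i ^ 2 / 2 * s else 0)
      ≤ (2 * R + 1) ^ d * s * (∑ i ∈ S, w i ^ 2) / 2 := by
    rw [Finset.mul_sum, Finset.sum_div]
    refine Finset.sum_le_sum fun i _ => ?_
    rw [← Finset.sum_filter, Finset.sum_const, nsmul_eq_mul]
    have hcard : ((S.filter fun j => ∀ k, |i k - j k| ≤ (R : ℤ)).card : ℝ) ≤ (2 * R + 1) ^ d := by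
      exact_mod_cast card_filter_close_le S R i
    calc _ ≤ (2 * (R : ℝ) + 1) ^ d * (w i ^ 2 / 2 * s) :=
          mul_le_mul_of_nonneg_right hcard (by positivity)
      _ = _ := by ring
  have hcol : ∑ i ∈ S, ∑ j ∈ S, (if ∀ k, |i k - j k| ≤ (R : ℤ) then w j ^ 2 / 2 * s else 0)
      ≤ (2 * R + 1) ^ d * s * (∑ i ∈ S, w i ^ 2) / 2 := by
    rw [Finset.sum_comm]
    simpa only [abs_sub_comm] using hrow
  calc ∫ ω, (∑ i ∈ S, w i * Y i ω) ^ 2 ∂P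
      = ∫ ω, ∑ i ∈ S, ∑ j ∈ S, w i * w j * (Y i ω * Y j ω) ∂P := by
        congr 1 with ω
        rw [sq, Finset.sum_mul_sum]
        refine Finset.sum_congr rfl fun i _ => Finset.sum_congr rfl fun j _ => by ring
    _ = ∑ i ∈ S, ∑ j ∈ S, w i * w j * ∫ ω, Y i ω * Y j ω ∂P := by
        rw [integral_finsetSum _ fun i _ => integrable_finsetSum _ fun j _ =>
          (hint i j).const_mul _]
        refine Finset.sum_congr rfl fun i _ => ?_
        rw [integral_finsetSum _ fun j _ => (hint i j).const_mul _]
        exact Finset.sum_congr rfl fun j _ => integral_const_mul _ _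
    _ ≤ ∑ i ∈ S, ∑ j ∈ S,
          ((if ∀ k, |i k - j k| ≤ (R : ℤ) then w i ^ 2 / 2 * s else 0)
            + if ∀ k, |i k - j k| ≤ (R : ℤ) then w j ^ 2 / 2 * s else 0) := by
        refine Finset.sum_le_sum fun i _ => Finset.sum_le_sum fun j _ => (hterm i j).trans ?_
        split_ifs
        · exact le_of_eq (by ring)
        · simp
    _ ≤ _ := by
        simp only [Finset.sum_add_distrib]
        linarith

theorem memLp_sum (h : IsFiniteRangeField Y R P) (S : Finset (Fin d → ℤ)) :
    MemLp (fun ω => ∑ i ∈ S, Y i ω) 2 P :=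
  memLp_finsetSum S fun i _ => h.memLp i

theorem integral_sum_sq_le (h : IsFiniteRangeField Y R P) (S : Finset (Fin d → ℤ)) :
    ∫ ω, (∑ i ∈ S, Y i ω) ^ 2 ∂P ≤ (2 * R + 1) ^ d * (∫ ω, Y 0 ω ^ 2 ∂P) * S.card := by
  simpa using h.integral_sum_mul_sq_le (fun _ => 1) S

/-- The `L²` distance between the sum over `S` and the sum over a subset `U`, each with its own
normalization. -/
theorem integral_sub_sq_le (h : IsFiniteRangeField Y R P) {U S : Finset (Fin d → ℤ)}
    (hUS : U ⊆ S) (A B : ℝ) :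
    ∫ ω, (A * ∑ i ∈ S, Y i ω - B * ∑ i ∈ U, Y i ω) ^ 2 ∂P
      ≤ (2 * R + 1) ^ d * (∫ ω, Y 0 ω ^ 2 ∂P)
        * (A ^ 2 * S.card - 2 * (A * B * U.card) + B ^ 2 * U.card) := by
  classical
  have hU : ∀ f : (Fin d → ℤ) → ℝ, ∑ i ∈ S, (if i ∈ U then f i else 0) = ∑ i ∈ U, f i := fun f => by
    rw [← Finset.sum_filter, Finset.filter_mem_eq_inter, Finset.inter_eq_right.2 hUS]
  have h1 := h.integral_sum_mul_sq_le (fun i => A - if i ∈ U then B else 0) S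
  have e1 : ∀ ω, ∑ i ∈ S, (A - if i ∈ U then B else 0) * Y i ω
      = A * ∑ i ∈ S, Y i ω - B * ∑ i ∈ U, Y i ω := fun ω => by
    rw [Finset.mul_sum, Finset.mul_sum, ← hU fun i => B * Y i ω, ← Finset.sum_sub_distrib]
    exact Finset.sum_congr rfl fun i _ => by split_ifs <;> ring
  have e2 : ∑ i ∈ S, (A - if i ∈ U then B else 0) ^ 2
      = A ^ 2 * S.card - 2 * (A * B * U.card) + B ^ 2 * U.card := by
    have : ∀ i, (A - if i ∈ U then B else 0) ^ 2
        = A ^ 2 + if i ∈ U then B ^ 2 - 2 * (A * B) else 0 := fun i => by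
      split_ifs <;> ring
    simp only [this, Finset.sum_add_distrib, hU]
    simp only [Finset.sum_const, nsmul_eq_mul]
    ring
  rw [e2] at h1
  simpa only [e1] using h1

variable [IsProbabilityMeasure P]

/-- Blocks separated by corridors of width `R` contribute independent, identically distributed sums. -/
theorem charFun_sum_biUnion_block (h : IsFiniteRangeField Y R P) (o : Fin d → ℤ) (m : ℕ)
    (C : Finset (Fin d → ℤ)) (t : ℝ) :
    charFun (P.map fun ω => ∑ x ∈ C.biUnion (block o (m + R) m), Y x ω) t
      = charFun (P.map fun ω => ∑ j ∈ cube d m, Y j ω) t ^ C.card := by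
  classical
  have hm : ∀ S : Finset (Fin d → ℤ), AEMeasurable (fun ω => ∑ i ∈ S, Y i ω) P := fun S =>
    (h.memLp_sum S).aestronglyMeasurable.aemeasurable
  induction C using Finset.induction_on with
  | empty => simp
  | insert c C hc ih =>
    have hsep : ∀ x ∈ block o (m + R) m c, ∀ y ∈ C.biUnion (block o (m + R) m),
        ∃ k, (R : ℤ) < |x k - y k| := fun x hx y hy => by
      obtain ⟨c', hc', hy⟩ := Finset.mem_biUnion.1 hy
      exact exists_lt_abs_sub_of_mem_block (fun e => hc (by rwa [e])) hx hy
    have hdisj : Disjoint (block o (m + R) m c) (C.biUnion (block o (m + R) m)) :=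
      Finset.disjoint_left.2 fun x hx hx' => by
        obtain ⟨k, hk⟩ := hsep x hx x hx'
        simp at hk
        omega
    simp only [Finset.biUnion_insert, Finset.sum_union hdisj]
    rw [(h.indepFun_sum _ _ hsep).charFun_map_fun_add_eq_mul (hm _) (hm _), Pi.mul_apply, ih,
      Finset.card_insert_of_notMem hc, pow_succ']
    congr 2
    simp only [block, Finset.sum_map, addLeftEmbedding_apply]
    exact (h.identDistrib_sum _ _).map_eq

/-- For large `L` the characteristic function of the normalized sum over the box is close to the
Gaussian one whose variance is that of a block divided by the volume of a cell. The error is governed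
by the proportion `1 - (m / (m + R))^d` of sites that lie in the corridors. -/
theorem eventually_norm_charFun_sub_lt (h : IsFiniteRangeField Y R P) (hd : 1 ≤ d) {m : ℕ}
    (hm : 0 < m) (t : ℝ) {ε : ℝ}
    (hε : |t| * √((2 * R + 1) ^ d * (∫ ω, Y 0 ω ^ 2 ∂P) * (1 - ((m : ℝ) / (m + R)) ^ d)) < ε) :
    ∀ᶠ L : ℕ in atTop,
      ‖charFun (P.map fun ω => 1 / (2 * (L : ℝ) + 1) ^ ((d : ℝ) / 2) * ∑ i ∈ box d L, Y i ω) t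
        - Complex.exp (-(((∫ ω, (∑ j ∈ cube d m, Y j ω) ^ 2 ∂P) / (m + R) ^ d : ℝ) : ℂ)
            * t ^ 2 / 2)‖ < ε := by
  set K := (2 * (R : ℝ) + 1) ^ d * ∫ ω, Y 0 ω ^ 2 ∂P
  set V := ∫ ω, (∑ j ∈ cube d m, Y j ω) ^ 2 ∂P
  set ρ := ((m : ℝ) / (m + R)) ^ d with hρ
  -- The number of whole cells, of side `m + R`, that fit along a side of the box.
  set n : ℕ → ℕ := fun L => (2 * L + 1) / (m + R)
  set Z : Ω → ℝ := fun ω => ∑ j ∈ cube d m, Y j ω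
  have hq : 0 < m + R := by omega
  have hmR : (0 : ℝ) < m := by exact_mod_cast hm
  have hM : ∀ L : ℕ, (0 : ℝ) < 2 * L + 1 := fun L => by positivity
  have hML : Tendsto (fun L : ℕ => 2 * L + 1) atTop atTop :=
    tendsto_atTop_mono (fun L => by simp only [id]; omega) tendsto_id
  have hnlim : Tendsto n atTop atTop := (Nat.tendsto_div_const_atTop hq.ne').comp hML
  have hnd : Tendsto (fun L => n L ^ d) atTop atTop :=
    (tendsto_pow_atTop (by omega)).comp hnlim
  -- Whole cells fill up the box asymptotically.
  have hcov : Tendsto (fun L : ℕ => (((m : ℝ) + R) * n L / (2 * L + 1)) ^ d) atTop (𝓝 1) := by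
    have h1 : Tendsto (fun L : ℕ => ((m : ℝ) + R) * n L / (2 * L + 1)) atTop (𝓝 1) := by
      have hlow : Tendsto (fun L : ℕ => 1 - ((m : ℝ) + R) / ((2 * L + 1 : ℕ) : ℝ)) atTop (𝓝 1) := by
        simpa using tendsto_const_nhds.sub
          ((tendsto_const_nhds (x := (m : ℝ) + R)).div_atTop
            (tendsto_natCast_atTop_atTop.comp hML))
      refine tendsto_of_tendsto_of_tendsto_of_le_of_le hlow tendsto_const_nhds
        (fun L => ?_) (fun L => ?_)
      · have h2 : 2 * L + 1 < (m + R) * n L + (m + R) := Nat.lt_mul_div_succ _ hq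
        have h3 : (2 * (L : ℝ) + 1) < (m + R) * n L + (m + R) := by exact_mod_cast h2
        simp only
        push_cast
        rw [le_div_iff₀ (hM L), sub_mul, div_mul_cancel₀ _ (hM L).ne']
        linarith
      · have h2 : (m + R) * n L ≤ 2 * L + 1 := Nat.mul_div_le _ _
        have h3 : ((m : ℝ) + R) * n L ≤ 2 * L + 1 := by exact_mod_cast h2
        simp only
        rw [div_le_one (hM L)]
        exact h3
    simpa using h1.pow d
  have hbound : Tendsto (fun L : ℕ =>
      |t| * √(K * (1 - 2 * (ρ * √((((m : ℝ) + R) * n L / (2 * L + 1)) ^ d)) + ρ))) atTop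
      (𝓝 (|t| * √(K * (1 - ρ)))) := by
    have h1 := ((((hcov.sqrt.const_mul ρ).const_mul 2).const_sub 1).add_const ρ).const_mul K
    have e : K * (1 - 2 * (ρ * √1) + ρ) = K * (1 - ρ) := by rw [Real.sqrt_one]; ring
    rw [e] at h1
    exact h1.sqrt.const_mul |t|
  have hZ2 : MemLp Z 2 P := h.memLp_sum _
  have hZ0 : ∫ ω, Z ω ∂P = 0 := by
    rw [integral_finsetSum _ fun i _ => (h.memLp i).integrable one_le_two]
    simp [h.integral_eq_zero]
  have hiid : Tendsto (fun L : ℕ =>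
      charFun (P.map Z) ((√((n L ^ d : ℕ) : ℝ))⁻¹ * ((√((m + R : ℝ) ^ d))⁻¹ * t)) ^ (n L ^ d)) atTop
      (𝓝 (Complex.exp (-((V / (m + R) ^ d : ℝ) : ℂ) * t ^ 2 / 2))) := by
    have h1 := (tendsto_charFun_map_inv_sqrt_pow hZ2 hZ0 ((√((m + R : ℝ) ^ d))⁻¹ * t)).comp hnd
    have e : Complex.exp (-(∫ ω, Z ω ^ 2 ∂P) * ((√((m + R : ℝ) ^ d))⁻¹ * t : ℝ) ^ 2 / 2)
        = Complex.exp (-((V / (m + R) ^ d : ℝ) : ℂ) * t ^ 2 / 2) := by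
      have h2 : V / (m + R : ℝ) ^ d = V / √((m + R : ℝ) ^ d) ^ 2 := by
        rw [Real.sq_sqrt (by positivity)]
      rw [show ∫ ω, Z ω ^ 2 ∂P = V from rfl, h2]
      push_cast
      ring_nf
    rwa [e] at h1
  have hlim := hbound.add (tendsto_iff_norm_sub_tendsto_zero.1 hiid)
  rw [add_zero] at hlim
  filter_upwards [hlim.eventually_lt_const hε, hnlim.eventually_gt_atTop 0] with L hL hnL
  refine lt_of_le_of_lt ?_ hL
  -- `U` collects the blocks inside the box; the sum over `U` is normalized by the volume of the
  -- cells containing them, rather than by that of the box.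
  set U := (cube d (n L)).biUnion (block (fun _ => -(L : ℤ)) (m + R) m) with hU
  set A := 1 / (2 * (L : ℝ) + 1) ^ ((d : ℝ) / 2) with hA
  set B := (√((n L ^ d : ℕ) : ℝ))⁻¹ * (√((m + R : ℝ) ^ d))⁻¹ with hB
  have hUc : (U.card : ℝ) = n L ^ d * m ^ d := by
    rw [hU, card_biUnion_block, card_cube]
    push_cast
    rfl
  have hA' : A = (√((2 * (L : ℝ) + 1) ^ d))⁻¹ := by
    rw [hA, one_div, Real.sqrt_eq_rpow, ← Real.rpow_natCast, ← Real.rpow_mul (hM L).le,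
      mul_one_div]
  have hB' : B = (√(((m + R : ℝ) * n L) ^ d))⁻¹ := by
    rw [hB, ← mul_inv, ← Real.sqrt_mul (by positivity), mul_pow, mul_comm]
    push_cast
    rfl
  have hUS : U ⊆ box d L := biUnion_block_subset_box (by omega) (Nat.mul_div_le _ _)
  have hvar := h.integral_sub_sq_le hUS A B
  -- With these normalizations the bound on the squared `L²` distance is
  -- `K (1 - 2 ρ √(cells / box) + ρ)`, which tends to `K (1 - ρ)`.
  have hA2 : A ^ 2 * (box d L).card = 1 := by
    rw [hA', inv_pow, Real.sq_sqrt (by positivity), card_box]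
    push_cast
    exact inv_mul_cancel₀ (by positivity)
  have hB2 : B ^ 2 * U.card = ρ := by
    rw [hB', inv_pow, Real.sq_sqrt (by positivity), hUc, hρ, div_pow, mul_pow]
    field_simp
  have hAB : A * B * U.card = ρ * √((((m : ℝ) + R) * n L / (2 * L + 1)) ^ d) := by
    have hBne : B ≠ 0 := by rw [hB']; positivity
    have : A * B * U.card = B ^ 2 * U.card * (A * B⁻¹) := by field_simp
    rw [this, hB2, hA', hB', inv_inv, div_pow, Real.sqrt_div (by positivity)]
    ring
  rw [hA2, hB2, hAB] at hvar
  have hdiff := norm_charFun_map_sub_le ((h.memLp_sum (box d L)).const_mul A)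
    ((h.memLp_sum U).const_mul B) t
  have hchar : charFun (P.map fun ω => B * ∑ i ∈ U, Y i ω) t
      = charFun (P.map Z) ((√((n L ^ d : ℕ) : ℝ))⁻¹ * ((√((m + R : ℝ) ^ d))⁻¹ * t)) ^ (n L ^ d) := by
    rw [charFun_map_mul_comp (h.memLp_sum U).aestronglyMeasurable.aemeasurable,
      hU, h.charFun_sum_biUnion_block, card_cube, ← mul_assoc]
  refine (norm_sub_le_norm_sub_add_norm_sub _ (charFun (P.map fun ω => B * ∑ i ∈ U, Y i ω) t) _).trans
    (add_le_add (hdiff.trans ?_) (by rw [hchar]))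
  gcongr

/-- The central limit theorem for stationary fields of finite range on `ℤ^d`. -/
theorem exists_tendstoInDistribution (h : IsFiniteRangeField Y R P) (hd : 1 ≤ d) :
    ∃ v : NNReal, TendstoInDistribution
      (fun (L : ℕ) (ω : Ω) => 1 / (2 * (L : ℝ) + 1) ^ ((d : ℝ) / 2) * ∑ i ∈ box d L, Y i ω)
      atTop (id : ℝ → ℝ) (fun _ => P) (gaussianReal 0 v) := by
  set K := (2 * (R : ℝ) + 1) ^ d * ∫ ω, Y 0 ω ^ 2 ∂P
  have hK0 : 0 ≤ K := mul_nonneg (by positivity) (integral_nonneg fun ω => sq_nonneg _)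
  set v : ℕ → ℝ := fun m =>
    (∫ ω, (∑ j ∈ cube d (m + 1), Y j ω) ^ 2 ∂P) / (((m + 1 : ℕ) : ℝ) + R) ^ d with hv
  have hvK : ∀ m, v m ∈ Set.Icc 0 K := fun m => by
    have hpos : (0 : ℝ) < (((m + 1 : ℕ) : ℝ) + R) ^ d := by positivity
    refine ⟨div_nonneg (integral_nonneg fun ω => sq_nonneg _) hpos.le, ?_⟩
    rw [hv, div_le_iff₀ hpos]
    refine (h.integral_sum_sq_le _).trans (mul_le_mul_of_nonneg_left ?_ hK0)
    rw [card_cube, Nat.cast_pow]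
    gcongr
    simp
  -- The normalized block variances are bounded, so they converge along a subsequence of block
  -- sizes; the limit is the variance sought.
  obtain ⟨w, hw, φ, hφ, hlim⟩ := isCompact_Icc.tendsto_subseq hvK
  have hρ : Tendsto (fun m : ℕ => (((m + 1 : ℕ) : ℝ) / ((m + 1 : ℕ) + R)) ^ d) atTop (𝓝 1) := by
    have h1 : Tendsto (fun m : ℕ => (m : ℝ) / (m + R)) atTop (𝓝 1) := by
      simpa using tendsto_natCast_div_add_atTop (R : ℝ)
    simpa using ((tendsto_add_atTop_iff_nat 1).2 h1).pow d
  refine ⟨w.toNNReal, ⟨fun L => ((h.memLp_sum _).aestronglyMeasurable.aemeasurable.const_mul _),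
    aemeasurable_id, ProbabilityMeasure.tendsto_iff_tendsto_charFun.2 fun t => ?_⟩⟩
  simp only [ProbabilityMeasure.coe_mk, Measure.map_id]
  rw [charFun_gaussianReal, Metric.tendsto_nhds]
  intro ε hε
  have hlim1 : Tendsto (fun k => |t| * √(K * (1 - (((φ k + 1 : ℕ) : ℝ) / ((φ k + 1 : ℕ) + R)) ^ d)))
      atTop (𝓝 0) := by
    simpa using (((hρ.comp hφ.tendsto_atTop).const_sub 1).const_mul K).sqrt.const_mul |t|
  have hlim2 : Tendsto (fun k => Complex.exp (-(v (φ k) : ℂ) * t ^ 2 / 2)) atTop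
      (𝓝 (Complex.exp (-(w : ℂ) * t ^ 2 / 2))) := by
    have hcont : Continuous fun x : ℝ => Complex.exp (-(x : ℂ) * t ^ 2 / 2) := by fun_prop
    exact (hcont.tendsto w).comp hlim
  obtain ⟨k, hk1, hk2⟩ := ((hlim1.eventually_lt_const (half_pos hε)).and
    (Metric.tendsto_nhds.1 hlim2 _ (half_pos hε))).exists
  filter_upwards [h.eventually_norm_charFun_sub_lt hd (Nat.succ_pos (φ k)) t hk1] with L hL
  have e : Complex.exp (t * ((0 : ℝ) : ℂ) * Complex.I - (w.toNNReal : ℂ) * t ^ 2 / 2)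
      = Complex.exp (-(w : ℂ) * t ^ 2 / 2) := by
    congr 1
    have : ((w.toNNReal : ℝ) : ℂ) = (w : ℂ) := by rw [Real.coe_toNNReal w hw.1]
    rw [this]
    push_cast
    ring
  rw [e]
  refine (dist_triangle _ (Complex.exp (-(v (φ k) : ℂ) * t ^ 2 / 2)) _).trans_lt ?_
  rw [← add_halves ε]
  refine add_lt_add ?_ hk2
  rw [dist_eq_norm]
  exact hL

end IsFiniteRangeField

/-! ### Local functions of an i.i.d. family -/

theorem monomial_shift {d : ℕ} {Ω : Type*} (X : (Fin d → ℤ) → Ω → ℝ) (β : MultiIndex d)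
    (i : Fin d → ℤ) (ω : Ω) :
    monomial X (shift β i) ω = ∏ n ∈ β.support, X (n + i) ω ^ β n := by
  have hs : (shift β i).support = β.support.map (Equiv.addRight i).toEmbedding := rfl
  simp [monomial, Finsupp.prod, hs, shift_apply]

/-- Having finite moments of all orders is stable under products, by the Cauchy–Schwarz inequality. -/
theorem memLp_mul_of_forall_nat {Ω : Type*} [MeasurableSpace Ω] {P : Measure Ω} {f g : Ω → ℝ}
    (hf : ∀ p : ℕ, MemLp f p P) (hg : ∀ p : ℕ, MemLp g p P) (p : ℕ) :
    MemLp (fun ω => f ω * g ω) p P := by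
  have : ENNReal.HolderTriple ((2 * p : ℕ) : ENNReal) ((2 * p : ℕ) : ENNReal) p := ⟨by
    push_cast
    rw [ENNReal.mul_inv (Or.inl two_ne_zero) (Or.inl ENNReal.ofNat_ne_top), ← two_mul, ← mul_assoc,
      ENNReal.mul_inv_cancel two_ne_zero ENNReal.ofNat_ne_top, one_mul]⟩
  exact (hg (2 * p)).mul' (hf (2 * p))

theorem memLp_prod_pow_of_forall_nat {ι Ω : Type*} [MeasurableSpace Ω] {P : Measure Ω}
    [IsProbabilityMeasure P] {X : ι → Ω → ℝ} (hX : ∀ n (p : ℕ), MemLp (X n) p P) (s : Finset ι)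
    (b : ι → ℕ) (p : ℕ) : MemLp (fun ω => ∏ n ∈ s, X n ω ^ b n) p P := by
  classical
  have hpow : ∀ n k (p : ℕ), MemLp (fun ω => X n ω ^ k) p P := fun n k => by
    induction k with
    | zero => intro p; simpa using memLp_const (1 : ℝ)
    | succ k ih => simpa only [pow_succ] using memLp_mul_of_forall_nat ih (hX n)
  induction s using Finset.induction_on generalizing p with
  | empty => simpa using memLp_const (1 : ℝ)
  | insert n s hn ih =>
    simp only [Finset.prod_insert hn]
    exact memLp_mul_of_forall_nat (hpow n _) ih p

/-- An independent, identically distributed family on `ℤ^d` is stationary as a whole. -/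
theorem identDistrib_shift {d : ℕ} {Ω : Type*} [MeasurableSpace Ω] {P : Measure Ω}
    {X : (Fin d → ℤ) → Ω → ℝ} (hindep : iIndepFun X P)
    (hident : ∀ n m : Fin d → ℤ, IdentDistrib (X n) (X m) P P) (i : Fin d → ℤ) :
    IdentDistrib (fun ω n => X (n + i) ω) (fun ω n => X n ω) P P :=
  IdentDistrib.pi (fun n => hident (n + i) n) (hindep.precomp (add_left_injective i)) hindep

/-- Applying one function `G` of the coordinates in a finite window `F` to all the translates of an
i.i.d. family gives a field of finite range; `R` bounds the diameter of the window. -/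
theorem isFiniteRangeField_of_local {d : ℕ} {Ω : Type*} [MeasurableSpace Ω] {P : Measure Ω}
    {X : (Fin d → ℤ) → Ω → ℝ} (hindep : iIndepFun X P)
    (hident : ∀ n m : Fin d → ℤ, IdentDistrib (X n) (X m) P P)
    {G : ((Fin d → ℤ) → ℝ) → ℝ} (hG : Measurable G) {F : Finset (Fin d → ℤ)}
    (hGF : ∀ x y : (Fin d → ℤ) → ℝ, (∀ n ∈ F, x n = y n) → G x = G y)
    {R : ℕ} (hR : ∀ x ∈ F, ∀ y ∈ F, ∀ k, |x k - y k| ≤ (R : ℤ))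
    (hG2 : MemLp (fun ω => G fun n => X n ω) 2 P) (hG0 : ∫ ω, G (fun n => X n ω) ∂P = 0) :
    IsFiniteRangeField (fun i ω => G fun n => X (n + i) ω) R P where
  memLp i := (((identDistrib_shift hindep hident i).comp hG).memLp_iff).2 hG2
  integral_eq_zero i := (((identDistrib_shift hindep hident i).comp hG).integral_eq).trans hG0
  identDistrib_sum S i := by
    have hm : Measurable fun x : (Fin d → ℤ) → ℝ => ∑ j ∈ S, G fun n => x (n + j) :=
      Finset.measurable_fun_sum _ fun j _ => hG.comp (by fun_prop)
    have h := (identDistrib_shift hindep hident i).comp hm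
    have e : ∀ j n : Fin d → ℤ, n + (i + j) = n + j + i := fun j n => by abel
    simpa only [e, Function.comp_def] using h
  indepFun_sum S T hST := by
    classical
    -- The sites of the i.i.d. family on which the sum over `S` depends.
    let N : Finset (Fin d → ℤ) → Finset (Fin d → ℤ) := fun S => S.biUnion fun i => F.image (· + i)
    have hN : Disjoint (N S) (N T) := by
      refine Finset.disjoint_left.2 fun z hz hz' => ?_
      simp only [N, Finset.mem_biUnion, Finset.mem_image] at hz hz'
      obtain ⟨i, hi, x, hx, rfl⟩ := hz
      obtain ⟨j, hj, y, hy, hxy⟩ := hz'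
      obtain ⟨k, hk⟩ := hST i hi j hj
      have h1 := hR y hy x hx k
      have h2 : y k + j k = x k + i k := congrFun hxy k
      rw [show i k - j k = y k - x k by linarith] at hk
      exact absurd h1 (not_le.2 hk)
    -- A configuration on `N S` is extended by zero: by locality of `G` the values outside do not
    -- matter.
    let ext : (S : Finset (Fin d → ℤ)) → (N S → ℝ) → (Fin d → ℤ) → ℝ :=
      fun S z n => if h : n ∈ N S then z ⟨n, h⟩ else 0
    have hext : ∀ S, Measurable fun z : N S → ℝ => ∑ i ∈ S, G fun n => ext S z (n + i) := fun S =>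
      Finset.measurable_fun_sum _ fun i _ => hG.comp <| measurable_pi_lambda _ fun n => by
        by_cases h : n + i ∈ N S
        · simpa only [ext, h, dite_true] using measurable_pi_apply _
        · simpa only [ext, h, dite_false] using measurable_const
    have hsum : ∀ S : Finset (Fin d → ℤ), (fun ω => ∑ i ∈ S, G fun n => X (n + i) ω)
        = (fun z : N S → ℝ => ∑ i ∈ S, G fun n => ext S z (n + i))
          ∘ fun ω (n : N S) => X n ω := fun S => by
      ext ω
      refine Finset.sum_congr rfl fun i hi => hGF _ _ fun n hn => ?_
      have hmem : n + i ∈ N S :=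
        Finset.mem_biUnion.2 ⟨i, hi, Finset.mem_image_of_mem _ hn⟩
      simp only [ext, hmem, dite_true]
    rw [hsum S, hsum T]
    exact (hindep.indepFun_finset₀ (N S) (N T) hN
      fun n => (hident n n).aemeasurable_fst).comp (hext S) (hext T)

theorem exists_forall_abs_sub_le {d : ℕ} (F : Finset (Fin d → ℤ)) :
    ∃ R : ℕ, ∀ x ∈ F, ∀ y ∈ F, ∀ k, |x k - y k| ≤ (R : ℤ) := by
  refine ⟨∑ x ∈ F, ∑ y ∈ F, ∑ k, (x k - y k).natAbs, fun x hx y hy k => ?_⟩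
  rw [Int.abs_eq_natAbs, Nat.cast_le]
  calc (x k - y k).natAbs ≤ ∑ k, (x k - y k).natAbs :=
        Finset.single_le_sum (f := fun k => (x k - y k).natAbs) (by simp) (Finset.mem_univ k)
    _ ≤ ∑ y ∈ F, ∑ k, (x k - y k).natAbs :=
        Finset.single_le_sum (f := fun y => ∑ k, (x k - y k).natAbs) (by simp) hy
    _ ≤ _ := Finset.single_le_sum (f := fun x => ∑ y ∈ F, ∑ k, (x k - y k).natAbs) (by simp) hx

end AndersonCLT

theorem theorem3 (d : ℕ) (hd : 1 ≤ d)
    {Ω : Type*} [MeasurableSpace Ω] (P : Measure Ω) [IsProbabilityMeasure P]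
    (X : (Fin d → ℤ) → Ω → ℝ)
    (hindep : iIndepFun X P)
    (hident : ∀ n m : Fin d → ℤ, IdentDistrib (X n) (X m) P P)
    (hmoments : ∀ (n : Fin d → ℤ) (p : ℕ), MemLp (X n) (p : ENNReal) P)
    (hmean : ∀ n : Fin d → ℤ, ∫ ω, X n ω ∂P = 0)
    (B : Set (AndersonCLT.MultiIndex d)) (hB : ∀ β ∈ B, 0 < β 0)
    (a : B →₀ ℝ) :
    ∃ v : NNReal,
      TendstoInDistribution
        (fun (L : ℕ) (ω : Ω) =>
          1 / (2 * (L : ℝ) + 1) ^ ((d : ℝ) / 2) *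
            ∑ β ∈ a.support, a β *
              ∑ i ∈ AndersonCLT.box d L,
                (AndersonCLT.monomial X (AndersonCLT.shift (β : AndersonCLT.MultiIndex d) i) ω
                  - ∫ ω', AndersonCLT.monomial X
                      (AndersonCLT.shift (β : AndersonCLT.MultiIndex d) i) ω' ∂P))
        atTop (id : ℝ → ℝ) (fun _ => P) (gaussianReal 0 v) := by
  classical
  let mon : B → ((Fin d → ℤ) → ℝ) → ℝ := fun β x =>
    ∏ n ∈ (β : AndersonCLT.MultiIndex d).support, x n ^ (β : AndersonCLT.MultiIndex d) n
  let c : B → ℝ := fun β => ∫ ω, mon β (fun n => X n ω) ∂P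
  -- The centred polynomial whose translates are summed, and the finite window it depends on.
  let G : ((Fin d → ℤ) → ℝ) → ℝ := fun x => ∑ β ∈ a.support, a β * (mon β x - c β)
  let F : Finset (Fin d → ℤ) := a.support.biUnion fun β => (β : AndersonCLT.MultiIndex d).support
  have hmon : ∀ β, Measurable (mon β) := fun β => by fun_prop
  have hmon2 : ∀ β, MemLp (fun ω => mon β fun n => X n ω) 2 P := fun β => by
    exact_mod_cast AndersonCLT.memLp_prod_pow_of_forall_nat hmoments _ _ 2
  have hterm2 : ∀ β, MemLp (fun ω => a β * (mon β (fun n => X n ω) - c β)) 2 P := fun β =>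
    ((hmon2 β).sub (memLp_const _)).const_mul _
  have hG : Measurable G :=
    Finset.measurable_fun_sum _ fun β _ => ((hmon β).sub_const _).const_mul _
  have hGF : ∀ x y : (Fin d → ℤ) → ℝ, (∀ n ∈ F, x n = y n) → G x = G y := fun x y hxy => by
    refine Finset.sum_congr rfl fun β hβ => ?_
    have : mon β x = mon β y := Finset.prod_congr rfl fun n hn => by
      rw [hxy n (Finset.mem_biUnion.2 ⟨β, hβ, hn⟩)]
    rw [this]
  have hG0 : ∫ ω, G (fun n => X n ω) ∂P = 0 := by
    rw [integral_finsetSum _ fun β _ => (hterm2 β).integrable one_le_two]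
    refine Finset.sum_eq_zero fun β _ => ?_
    rw [integral_const_mul, integral_sub ((hmon2 β).integrable one_le_two) (integrable_const _)]
    simp [c]
  obtain ⟨R, hR⟩ := AndersonCLT.exists_forall_abs_sub_le F
  obtain ⟨v, hv⟩ := (AndersonCLT.isFiniteRangeField_of_local hindep hident hG hGF hR
    (memLp_finsetSum _ fun β _ => hterm2 β) hG0).exists_tendstoInDistribution hd
  refine ⟨v, ?_⟩
  -- By stationarity all the translates of a monomial have the same mean.
  have hc : ∀ (β : B) (i : Fin d → ℤ),
      ∫ ω, AndersonCLT.monomial X (AndersonCLT.shift (β : AndersonCLT.MultiIndex d) i) ω ∂P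
        = c β := fun β i => by
    simp only [AndersonCLT.monomial_shift]
    exact ((AndersonCLT.identDistrib_shift hindep hident i).comp (hmon β)).integral_eq
  convert hv using 3 with L ω
  refine congrArg _ ?_
  simp only [hc]
  simp only [AndersonCLT.monomial_shift, Finset.mul_sum, G, mon]
  rw [Finset.sum_comm]
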